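/- Let $\hat{\mathbb Z}=\prod_p\mathbb Z_p$ be the ring of profinite integers with its Haar probability measure, let $\mathbb A_{\mathbb Z}=\mathbb R\times\hat{\mathbb Z}$ be the adelic integers with the product of Lebesgue measure and this measure, and let $\iota:\mathbb Z\to\mathbb A_{\mathbb Z}$ be the diagonal embedding. For a finite-dimensional complex normed space $B$, a Schwartz--Bruhat function $F:\mathbb A_{\mathbb Z}\to B$ is a function of the form $F(x,y)=f(x,\,y \bmod q)$ for some integer $q\ge 1$ and some $f:\mathbb R\times\mathbb Z/q\mathbb Z\to B$ that is a Schwartz function of the real variable; its Fourier transform is the function on $\mathbb R\times\mathbb Q/\mathbb Z$ $$\mathcal F F(\xi,\alpha)=\int_{\mathbb A_{\mathbb Z}}F(x,y)\,e(x\xi+y\cdot\alpha)\,d\mu(x,y),\qquad e(\theta)=e^{2\pi i\theta},\quad y\cdot\left(\tfrac{a}{q}\bmod 1\right)=\tfrac{ya \bmod q}{q},$$ and $F$ has Fourier support in $\Omega\subset\mathbb R\times\mathbb Q/\mathbb Z$ if $\mathcal F F$ vanishes almost everywhere outside $\Omega$ (for Lebesgue measure times counting measure). Write $\mathcal SF=F\circ\iota$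 for the restriction of $F$ to $\mathbb Z$. **Theorem (Quantitative Shannon sampling theorem).** For every $0<p\le\infty$ and every $0<c_0<\frac12$ there is a constant $0<C<\infty$, depending only on $p$ and $c_0$, such that for every finite-dimensional complex normed space $B$, every integer $Q\ge1$ and every $B$-valued Schwartz--Bruhat function $F$ on $\mathbb A_{\mathbb Z}$ with Fourier support in $[-\frac{c_0}{Q},\frac{c_0}{Q}]\times\frac1Q\mathbb Z/\mathbb Z$, $$\|\mathcal SF\|_{\ell^p(\mathbb Z;B)}\le C\,\|F\|_{L^p(\mathbb A_{\mathbb Z};B)}\quad\text{and}\quad \|F\|_{L^p(\mathbb A_{\mathbb Z};B)}\le C\,\|\mathcal SF\|_{\ell^p(\mathbb Z;B)}.$$ -/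

import Mathlib

open MeasureTheory
open scoped ENNReal NNReal SchwartzMap

noncomputable section

namespace Adelic

instance factPrimePrimes (p : Nat.Primes) : Fact (Nat.Prime (p : ℕ)) := ⟨p.2⟩

/-- The profinite integers `Ẑ = ∏ₚ ℤₚ`, with the product topology and product ring structure. -/
abbrev ZHat : Type := ∀ p : Nat.Primes, ℤ_[(p : ℕ)]

instance : MeasurableSpace ZHat := borel ZHat

instance : BorelSpace ZHat := ⟨rfl⟩

/-- The Haar probability measure on the compact group `Ẑ`. -/
def haarZHat : Measure ZHat := Measure.addHaarMeasure (⊤ : TopologicalSpace.PositiveCompacts ZHat)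

instance : IsProbabilityMeasure haarZHat :=
  ⟨by
    have h := Measure.addHaarMeasure_self (K₀ := (⊤ : TopologicalSpace.PositiveCompacts ZHat))
    simpa [haarZHat] using h⟩

/-- The adelic integers `𝔸_ℤ = ℝ × Ẑ`. -/
abbrev AZ : Type := ℝ × ZHat

/-- The product Haar measure on `𝔸_ℤ`. -/
def haarAZ : Measure AZ := (volume : Measure ℝ).prod haarZHat

/-- The reduction homomorphism `y ↦ y mod n` from `Ẑ` to `ℤ/nℤ`: its component at a prime `p ∣ n`
(under the Chinese remainder isomorphism) is the reduction of `yₚ` modulo the exact power of `p`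
dividing `n`. -/
def modHom (n : ℕ) [NeZero n] : ZHat →+* ZMod n :=
  ((ZMod.equivPi n (NeZero.ne n)).symm : _ →+* ZMod n).comp
    (RingHom.pi fun p : n.primeFactors =>
      haveI : Fact (Nat.Prime (p : ℕ)) := ⟨Nat.prime_of_mem_primeFactors p.2⟩
      (PadicInt.toZModPow (p := (p : ℕ)) (n.factorization p)).comp
        (Pi.evalRingHom (fun q : Nat.Primes => ℤ_[(q : ℕ)])
          ⟨(p : ℕ), Nat.prime_of_mem_primeFactors p.2⟩))

/-- The group `ℚ/ℤ` of arithmetic frequencies. -/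
abbrev QModZ : Type := AddCircle (1 : ℚ)

instance : Countable QModZ := Quotient.countable

/-- `(y a mod q)/q` as an element of `ℝ/ℤ`. -/
def pairFrac (y : ZHat) (a : ℤ) (q : ℕ) [NeZero q] : UnitAddCircle :=
  ZMod.toAddCircle (modHom q y * (a : ZMod q))

/-- For `r = a/q` in lowest terms, `(y a mod q)/q` as an element of `ℝ/ℤ`. -/
def pairRat (y : ZHat) (r : ℚ) : UnitAddCircle :=
  haveI : NeZero r.den := ⟨r.den_nz⟩
  pairFrac y r.num r.den

theorem pairRat_add_int (y : ZHat) (r : ℚ) (k : ℤ) : pairRat y (r + k) = pairRat y r := by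
  have hden : (r + k).den = r.den := Rat.add_intCast_den r k
  have hnum : (r + k).num = r.num + k * r.den := by
    have h1 : ((r + k).num : ℚ) = (r + k) * (r + k).den := (Rat.mul_den_eq_num _).symm
    have h2 : (r.num : ℚ) = r * r.den := (Rat.mul_den_eq_num _).symm
    rw [hden] at h1
    have h3 : ((r + k).num : ℚ) = ((r.num + k * r.den : ℤ) : ℚ) := by
      push_cast
      rw [h1, h2]
      ring
    exact_mod_cast h3
  have key : ∀ (d e : ℕ) [NeZero d] [NeZero e] (a b : ℤ), d = e → a = b + k * e →
      pairFrac y a d = pairFrac y b e := by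
    intro d e _ _ a b hd ha
    subst hd ha
    simp [pairFrac]
  have : NeZero r.den := ⟨r.den_nz⟩
  have : NeZero (r + k).den := ⟨(r + k).den_nz⟩
  exact key _ _ _ _ hden hnum

/-- The pairing `Ẑ × ℚ/ℤ → ℝ/ℤ`, `y · (a/q mod 1) = (y a mod q)/q`. -/
def pairZHat (y : ZHat) (α : QModZ) : UnitAddCircle :=
  Quotient.liftOn' α (pairRat y) (by
    intro r s h
    obtain ⟨k, hk⟩ := AddSubgroup.mem_zmultiples_iff.mp (QuotientAddGroup.leftRel_apply.mp h)
    have hs : s = r + (k : ℚ) := by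
      simp at hk
      linarith
    rw [hs, pairRat_add_int])

/-- The pairing of `𝔸_ℤ = ℝ × Ẑ` with its dual `ℝ × ℚ/ℤ`. -/
def pairAZ (z : AZ) (ζ : ℝ × QModZ) : UnitAddCircle :=
  ((z.1 * ζ.1 : ℝ) : UnitAddCircle) + pairZHat z.2 ζ.2

section Functions

variable {B : Type*} [NormedAddCommGroup B] [NormedSpace ℂ B]

/-- Schwartz–Bruhat functions `𝔸_ℤ → B`: those of the form `(x, y) ↦ f (x, y mod q)` with `q ≥ 1`
and `f : ℝ × ℤ/qℤ → B` Schwartz in the real variable. -/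
def IsSchwartzBruhat (F : AZ → B) : Prop :=
  ∃ (q : ℕ) (_ : NeZero q) (f : ZMod q → 𝓢(ℝ, B)),
    ∀ (x : ℝ) (y : ZHat), F (x, y) = f (modHom q y) x

/-- The Fourier transform `∫ F(z) e(z · ζ) dz` on `𝔸_ℤ`, where `e(θ) = exp(2πiθ)`. -/
def fourierAZ (F : AZ → B) (ζ : ℝ × QModZ) : B :=
  ∫ z : AZ, (AddCircle.toCircle (pairAZ z ζ) : ℂ) • F z ∂haarAZ

/-- `F` is Fourier supported in `Ω`: its Fourier transform vanishes outside `Ω`, modulo null sets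
of the product of Lebesgue measure on `ℝ` and counting measure on `ℚ/ℤ`. -/
def FourierSupportedIn (F : AZ → B) (Ω : Set (ℝ × QModZ)) : Prop :=
  ∀ᵐ ζ ∂((volume : Measure ℝ).prod (Measure.count : Measure QModZ)), ζ ∉ Ω → fourierAZ F ζ = 0

end Functions

/-- The subgroup `(1/Q)ℤ/ℤ` of `ℚ/ℤ`, as a set. -/
def fracSubgroup (Q : ℕ) : Set QModZ := {α | ∃ a : ℤ, α = (((a : ℚ) / (Q : ℚ) : ℚ) : QModZ)}

/-- The inclusion `ι : ℤ → 𝔸_ℤ`, the diagonal embedding. -/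
def iota (n : ℤ) : AZ := ((n : ℝ), (n : ZHat))

/-- The sampling operator `𝒮 F = F ∘ ι`. -/
def sampling {B : Type*} (F : AZ → B) : ℤ → B := fun n => F (iota n)

end Adelic

end

/-!
The diagonal `ℤ` is a lattice of covolume one in `𝔸_ℤ`, with fundamental domain `(0, 1] × Ẑ`. The
condition on the Fourier support forces `F (x, y)` to depend on `y` only modulo `Q` and to be
band-limited to `[-c₀/Q, c₀/Q]` in `x`. Since `c₀ < 1/2`, Shannon's sampling formula on each
progression of step `Q` then expresses `F` at any point through its values on any single orbit
`z + ℤ`, with a kernel that is a dilated Schwartz function supported on `ℝ × QẐ`: its row and column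
sums over `ℤ`, even after raising it to a power in `(0, 1]`, are bounded independently of `Q`.
Schur's test therefore makes the `ℓᵖ` norms of `F` along all orbits comparable. The orbit of `0`
gives `𝒮 F`, and integrating the `p`-th powers over the fundamental domain gives `‖F‖_p`.
-/

open scoped FourierTransform

section Schur

theorem rpow_tsum_le_tsum_rpow {ι : Type*} (a : ι → ℝ≥0∞) {p : ℝ} (hp : 0 < p) (hp₁ : p ≤ 1) :
    (∑' i, a i) ^ p ≤ ∑' i, a i ^ p := by
  rw [← ENNReal.le_rpow_inv_iff hp, ENNReal.tsum_eq_iSup_sum]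
  refine iSup_le fun s => (ENNReal.le_rpow_inv_iff hp).mpr ?_
  calc (∑ i ∈ s, a i) ^ p ≤ ∑ i ∈ s, a i ^ p :=
        Finset.le_sum_of_subadditive (· ^ p) (ENNReal.zero_rpow_of_pos hp).le
          (fun x y => ENNReal.rpow_add_le_add_rpow x y hp.le hp₁) s a
    _ ≤ ∑' i, a i ^ p := ENNReal.sum_le_tsum s

theorem rpow_tsum_mul_le {ι : Type*} (w a : ι → ℝ≥0∞) {p : ℝ} (hp : 1 ≤ p) :
    (∑' i, w i * a i) ^ p ≤ (∑' i, w i) ^ (p - 1) * ∑' i, w i * a i ^ p := by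
  have hp₀ : 0 < p := zero_lt_one.trans_le hp
  rw [← ENNReal.le_rpow_inv_iff hp₀, ENNReal.tsum_eq_iSup_sum]
  refine iSup_le fun s => (ENNReal.le_rpow_inv_iff hp₀).mpr ?_
  calc (∑ i ∈ s, w i * a i) ^ p
      ≤ ((∑ i ∈ s, w i) ^ (1 - p⁻¹) * (∑ i ∈ s, w i * a i ^ p) ^ p⁻¹) ^ p := by
        gcongr
        exact ENNReal.inner_le_weight_mul_Lp_of_nonneg s hp w a
    _ = (∑ i ∈ s, w i) ^ (p - 1) * ∑ i ∈ s, w i * a i ^ p := by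
        rw [ENNReal.mul_rpow_of_nonneg _ _ hp₀.le, ENNReal.rpow_inv_rpow hp₀.ne',
          ← ENNReal.rpow_mul, sub_mul, inv_mul_cancel₀ hp₀.ne', one_mul]
    _ ≤ (∑' i, w i) ^ (p - 1) * ∑' i, w i * a i ^ p := by
        gcongr <;> exact ENNReal.sum_le_tsum s

variable {ι κ : Type*} {k : ι → κ → ℝ≥0∞} {A : ℝ≥0∞}

theorem tsum_tsum_mul_le (v : κ → ℝ≥0∞) (hcol : ∀ j, ∑' i, k i j ≤ A) :
    ∑' i, ∑' j, k i j * v j ≤ A * ∑' j, v j := by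
  rw [ENNReal.tsum_comm, ← ENNReal.tsum_mul_left]
  gcongr with j
  rw [ENNReal.tsum_mul_right]
  gcongr
  exact hcol j

theorem tsum_rpow_le_of_le_one {u : ι → ℝ≥0∞} {v : κ → ℝ≥0∞} {p : ℝ} (hp : 0 < p) (hp₁ : p ≤ 1)
    (hu : ∀ i, u i ≤ ∑' j, k i j * v j) (hcol : ∀ j, ∑' i, k i j ^ p ≤ A) :
    ∑' i, u i ^ p ≤ A * ∑' j, v j ^ p := by
  refine le_trans ?_ (tsum_tsum_mul_le _ hcol)
  gcongr with i
  calc u i ^ p ≤ (∑' j, k i j * v j) ^ p := by gcongr; exact hu i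
    _ ≤ ∑' j, (k i j * v j) ^ p := rpow_tsum_le_tsum_rpow _ hp hp₁
    _ = ∑' j, k i j ^ p * v j ^ p := by simp only [ENNReal.mul_rpow_of_nonneg _ _ hp.le]

theorem tsum_rpow_le_of_one_le {u : ι → ℝ≥0∞} {v : κ → ℝ≥0∞} {p : ℝ} (hp : 1 ≤ p)
    (hu : ∀ i, u i ≤ ∑' j, k i j * v j) (hrow : ∀ i, ∑' j, k i j ≤ A)
    (hcol : ∀ j, ∑' i, k i j ≤ A) : ∑' i, u i ^ p ≤ A ^ p * ∑' j, v j ^ p :=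
  calc ∑' i, u i ^ p ≤ ∑' i, A ^ (p - 1) * ∑' j, k i j * v j ^ p := by
        gcongr with i
        calc u i ^ p ≤ (∑' j, k i j * v j) ^ p := by gcongr; exact hu i
          _ ≤ (∑' j, k i j) ^ (p - 1) * ∑' j, k i j * v j ^ p := rpow_tsum_mul_le _ _ hp
          _ ≤ A ^ (p - 1) * ∑' j, k i j * v j ^ p := by gcongr; exact hrow i
    _ ≤ A ^ (p - 1) * (A * ∑' j, v j ^ p) := by
        rw [ENNReal.tsum_mul_left]
        gcongr
        exact tsum_tsum_mul_le _ hcol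
    _ = A ^ p * ∑' j, v j ^ p := by
        nth_rw 2 [← ENNReal.rpow_one A]
        rw [← mul_assoc, ← ENNReal.rpow_add_of_nonneg _ _ (by linarith) zero_le_one,
          sub_add_cancel]

variable [MeasurableSpace ι] [MeasurableSingletonClass ι] [MeasurableSpace κ]
  [MeasurableSingletonClass κ] {E E' : Type*} [NormedAddCommGroup E] [NormedAddCommGroup E']

theorem eLpNorm_count_eq_tsum (u : ι → E) {p : ℝ≥0∞} (hp : p ≠ 0) (hp_top : p ≠ ∞) :
    eLpNorm u p Measure.count = (∑' i, ‖u i‖ₑ ^ p.toReal) ^ p.toReal⁻¹ := by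
  rw [eLpNorm_eq_lintegral_rpow_enorm_toReal hp hp_top, lintegral_count, one_div]

theorem eLpNorm_top_count (u : ι → E) : eLpNorm u ∞ Measure.count = ⨆ i, ‖u i‖ₑ := by
  simp [eLpNorm_exponent_top, eLpNormEssSup]

/-- Schur's test; for `p < 1` the quasi-norm is only `p`-subadditive, so the `p`-th powers of the
kernel have to be summable. -/
theorem eLpNorm_count_le_of_tsum_kernel_le {u : ι → E} {v : κ → E'} {p : ℝ≥0∞} (hp : p ≠ 0)
    (hu : ∀ i, ‖u i‖ₑ ≤ ∑' j, k i j * ‖v j‖ₑ)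
    (hrow : ∀ i, ∑' j, k i j ^ (min p 1).toReal ≤ A)
    (hcol : ∀ j, ∑' i, k i j ^ (min p 1).toReal ≤ A) :
    eLpNorm u p Measure.count ≤ A ^ (min p 1).toReal⁻¹ * eLpNorm v p Measure.count := by
  rcases eq_or_ne p ∞ with rfl | hp_top
  · simp only [le_top, inf_of_le_right, ENNReal.toReal_one, ENNReal.rpow_one, inv_one] at hrow ⊢
    rw [eLpNorm_top_count, eLpNorm_top_count]
    refine iSup_le fun i => (hu i).trans ?_
    calc ∑' j, k i j * ‖v j‖ₑ ≤ ∑' j, k i j * ⨆ j, ‖v j‖ₑ := by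
          gcongr with j
          exact le_iSup (fun j => ‖v j‖ₑ) j
      _ ≤ A * ⨆ j, ‖v j‖ₑ := by
          rw [ENNReal.tsum_mul_right]
          gcongr
          exact hrow i
  have hp' : 0 < p.toReal := ENNReal.toReal_pos hp hp_top
  rw [eLpNorm_count_eq_tsum u hp hp_top, eLpNorm_count_eq_tsum v hp hp_top]
  rcases le_total p 1 with hp₁ | hp₁
  · rw [min_eq_left hp₁] at hcol ⊢
    rw [← ENNReal.mul_rpow_of_nonneg _ _ (by positivity)]
    gcongr
    exact tsum_rpow_le_of_le_one hp' (ENNReal.toReal_le_of_le_ofReal zero_le_one (by simpa)) hu hcol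
  · simp only [min_eq_right hp₁, ENNReal.toReal_one, ENNReal.rpow_one, inv_one] at hrow hcol ⊢
    rw [ENNReal.rpow_inv_le_iff hp', ENNReal.mul_rpow_of_nonneg _ _ hp'.le,
      ENNReal.rpow_inv_rpow hp'.ne']
    exact tsum_rpow_le_of_one_le
      ((ENNReal.ofReal_le_iff_le_toReal hp_top).mp (by simpa)) hu hrow hcol

end Schur

section Unfolding

variable {G α E : Type*} [AddGroup G] [Countable G] [MeasurableSpace G]
  [MeasurableSingletonClass G] [MeasurableSpace α] [AddAction G α] [MeasurableConstVAdd G α]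
  {μ : Measure α} [VAddInvariantMeasure G α μ] {D : Set α} [NormedAddCommGroup E]
  {F : α → E} {p C : ℝ≥0∞}

theorem lintegral_enorm_rpow_eq_setLIntegral_orbit (hD : IsAddFundamentalDomain G D μ)
    (hF : AEStronglyMeasurable F μ) (hp : p ≠ 0) (hp_top : p ≠ ∞) :
    ∫⁻ z, ‖F z‖ₑ ^ p.toReal ∂μ =
      ∫⁻ z in D, eLpNorm (fun g : G => F (g +ᵥ z)) p Measure.count ^ p.toReal ∂μ := by
  have hp' : p.toReal ≠ 0 := (ENNReal.toReal_pos hp hp_top).ne'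
  have hmeas (g : G) : AEMeasurable (fun z => ‖F (g +ᵥ z)‖ₑ ^ p.toReal) (μ.restrict D) :=
    (((hF.enorm.pow_const _).comp_quasiMeasurePreserving
      (measurePreserving_vadd g μ).quasiMeasurePreserving)).restrict
  rw [hD.lintegral_eq_tsum'', ← lintegral_tsum hmeas]
  simp only [eLpNorm_count_eq_tsum _ hp hp_top, ENNReal.rpow_inv_rpow hp']

theorem eLpNorm_le_of_forall_orbit_le (hD : IsAddFundamentalDomain G D μ)
    (hF : AEStronglyMeasurable F μ) (hp : p ≠ 0)
    (h : ∀ z, eLpNorm (fun g : G => F (g +ᵥ z)) p Measure.count ≤ C) :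
    eLpNorm F p μ ≤ C * μ D ^ p.toReal⁻¹ := by
  rcases eq_or_ne p ∞ with rfl | hp_top
  · simp only [eLpNorm_top_count, iSup_le_iff] at h
    simpa using eLpNormEssSup_le_of_ae_enorm_bound (.of_forall fun z => by simpa using h z 0)
  have hp' : 0 < p.toReal := ENNReal.toReal_pos hp hp_top
  rw [eLpNorm_eq_lintegral_rpow_enorm_toReal hp hp_top, one_div, ENNReal.rpow_inv_le_iff hp',
    ENNReal.mul_rpow_of_nonneg _ _ hp'.le, ENNReal.rpow_inv_rpow hp'.ne',
    lintegral_enorm_rpow_eq_setLIntegral_orbit hD hF hp hp_top, ← setLIntegral_const]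
  gcongr with z
  exact h z

theorem le_eLpNorm_of_forall_le_orbit [NeZero μ] (hD : IsAddFundamentalDomain G D μ)
    (hF : AEStronglyMeasurable F μ) (hp : p ≠ 0)
    (h : ∀ z, C ≤ eLpNorm (fun g : G => F (g +ᵥ z)) p Measure.count) :
    C * μ D ^ p.toReal⁻¹ ≤ eLpNorm F p μ := by
  rcases eq_or_ne p ∞ with rfl | hp_top
  · have hae : ∀ᵐ z ∂μ, ∀ g : G, ‖F (g +ᵥ z)‖ₑ ≤ eLpNorm F ∞ μ := ae_all_iff.mpr fun g =>
      (measurePreserving_vadd g μ).quasiMeasurePreserving.ae (enorm_ae_le_eLpNormEssSup F μ)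
    obtain ⟨z, hz⟩ := hae.exists
    simpa using (h z).trans ((eLpNorm_top_count _).trans_le (iSup_le hz))
  have hp' : 0 < p.toReal := ENNReal.toReal_pos hp hp_top
  rw [eLpNorm_eq_lintegral_rpow_enorm_toReal hp hp_top, one_div, ENNReal.le_rpow_inv_iff hp',
    ENNReal.mul_rpow_of_nonneg _ _ hp'.le, ENNReal.rpow_inv_rpow hp'.ne',
    lintegral_enorm_rpow_eq_setLIntegral_orbit hD hF hp hp_top, ← setLIntegral_const]
  gcongr with z
  exact h z

end Unfolding

section Decay

variable {E F : Type*} [NormedAddCommGroup E] [NormedSpace ℝ E] [NormedAddCommGroup F]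
  [NormedSpace ℝ F]

theorem exists_norm_rpow_le_mul_one_add_norm_rpow (φ : 𝓢(E, F)) {r : ℝ} (hr : 0 < r) (s : ℝ) :
    ∃ C, 0 ≤ C ∧ ∀ x, ‖φ x‖ ^ r ≤ C * (1 + ‖x‖) ^ (-s) := by
  obtain ⟨k, hk⟩ := exists_nat_ge (s / r)
  obtain ⟨C, hC₀, hC⟩ : ∃ C : ℝ, 0 ≤ C ∧ ∀ x, (1 + ‖x‖) ^ k * ‖φ x‖ ≤ C :=
    ⟨_, by positivity, fun x => le_of_eq_of_le (by simp)
      (SchwartzMap.one_add_le_sup_seminorm_apply (𝕜 := ℝ) (m := (k, 0)) le_rfl le_rfl φ x)⟩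
  refine ⟨C ^ r, by positivity, fun x => ?_⟩
  have hx : ‖φ x‖ ≤ C * (1 + ‖x‖) ^ (-k : ℝ) := by
    rw [Real.rpow_neg (by positivity), Real.rpow_natCast, ← div_eq_mul_inv,
      le_div_iff₀' (by positivity)]
    exact hC x
  calc ‖φ x‖ ^ r ≤ (C * (1 + ‖x‖) ^ (-k : ℝ)) ^ r := by gcongr
    _ = C ^ r * (1 + ‖x‖) ^ (-k * r) := by
      rw [Real.mul_rpow hC₀ (by positivity), ← Real.rpow_mul (by positivity)]
    _ ≤ C ^ r * (1 + ‖x‖) ^ (-s) := by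
      gcongr
      · simp
      · linarith [(div_le_iff₀ hr).mp hk]

theorem abs_add_neg_half_le (s : ℝ) (hs₀ : 0 ≤ s) (hs₁ : s ≤ 1) (m : ℝ) :
    |m + -(1 / 2)| ≤ 1 + |s - m| := by
  have : |s - 1 / 2| ≤ 1 := abs_le.mpr ⟨by linarith, by linarith⟩
  calc |m + -(1 / 2)| = |(s - 1 / 2) - (s - m)| := by ring_nf
    _ ≤ 1 + |s - m| := (abs_sub _ _).trans (by gcongr)

theorem exists_tsum_enorm_rpow_sub_intCast_le (φ : 𝓢(ℝ, F)) {r : ℝ} (hr : 0 < r) :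
    ∃ K : ℝ≥0, ∀ t : ℝ, ∑' n : ℤ, ‖φ (t - n)‖ₑ ^ r ≤ K := by
  obtain ⟨C, hC₀, hC⟩ := exists_norm_rpow_le_mul_one_add_norm_rpow φ hr 2
  -- The shift by `1 / 2` keeps the denominators away from zero.
  set w : ℤ → ℝ := fun m => C * (1 / |(m : ℝ) + -(1 / 2)| ^ (2 : ℝ))
  have hw : Summable w := ((Real.summable_one_div_int_add_rpow _ _).mpr one_lt_two).mul_left C
  have hφw (t : ℝ) (m : ℤ) : ‖φ (Int.fract t - m)‖ ^ r ≤ w m := by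
    have hm : (m : ℝ) + -(1 / 2) ≠ 0 := fun h => by
      have : 2 * m = 1 := by exact_mod_cast (by linarith : 2 * (m : ℝ) = 1)
      omega
    refine (hC _).trans ?_
    rw [Real.rpow_neg (by positivity), ← one_div]
    simp only [w]
    gcongr
    exact abs_add_neg_half_le _ (Int.fract_nonneg t) (Int.fract_lt_one t).le m
  refine ⟨(∑' m, w m).toNNReal, fun t => ?_⟩
  calc ∑' n : ℤ, ‖φ (t - n)‖ₑ ^ r = ∑' m : ℤ, ‖φ (Int.fract t - m)‖ₑ ^ r := by
        rw [← (Equiv.addLeft ⌊t⌋).tsum_eq]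
        simp [← sub_sub]
    _ ≤ ∑' m, ENNReal.ofReal (w m) := by
        gcongr with m
        rw [← ofReal_norm, ENNReal.ofReal_rpow_of_nonneg (norm_nonneg _) hr.le]
        exact ENNReal.ofReal_le_ofReal (hφw t m)
    _ = (∑' m, w m).toNNReal :=
        (ENNReal.ofReal_tsum_of_nonneg (fun m => by positivity) hw).symm

theorem summable_norm_sub_intCast (φ : 𝓢(ℝ, F)) (t : ℝ) :
    Summable fun n : ℤ => ‖φ (t - n)‖ := by
  obtain ⟨K, hK⟩ := exists_tsum_enorm_rpow_sub_intCast_le φ one_pos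
  exact ENNReal.tsum_coe_ne_top_iff_summable_coe.mp
    (ne_top_of_le_ne_top ENNReal.coe_ne_top (by simpa using! hK t))

end Decay

section BandLimited

variable {B : Type*} [NormedAddCommGroup B] [NormedSpace ℂ B] {c : ℝ}

/-- A function on the line is band-limited to `[-c, c]` if its Fourier transform vanishes at every
frequency `ξ` with `c < |ξ|`. -/
def IsBandLimited (c : ℝ) (g : ℝ → B) : Prop :=
  ∀ ξ, c < |ξ| → 𝓕 g ξ = 0

theorem IsBandLimited.clm_comp [CompleteSpace B] {B' : Type*} [NormedAddCommGroup B']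
    [NormedSpace ℂ B'] [CompleteSpace B'] {g : ℝ → B} (hg : IsBandLimited c g)
    (hg_int : Integrable g) (L : B →L[ℂ] B') : IsBandLimited c (fun x => L (g x)) := fun ξ hξ => by
  have hint := (Real.fourierIntegral_convergent_iff ξ).mpr hg_int
  have hL : 𝓕 (fun x => L (g x)) ξ = L (𝓕 g ξ) := by
    rw [Real.fourier_eq, Real.fourier_eq, ← L.integral_comp_comm hint]
    simp only [Circle.smul_def, map_smul]
  rw [hL, hg ξ hξ, map_zero]

theorem fourier_comp_add_mul (g : ℝ → B) (a : ℝ) {T : ℝ} (hT : 0 < T) (ξ : ℝ) :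
    𝓕 (fun t : ℝ => g (a + T * t)) ξ = T⁻¹ • (𝐞 (a * (ξ / T)) : ℂ) • 𝓕 g (ξ / T) := by
  have h (t : ℝ) : 𝐞 (-(t * ξ)) • g (a + T * t) =
      (𝐞 (a * (ξ / T)) : ℂ) • (𝐞 (-((a + T * t) * (ξ / T))) • g (a + T * t)) := by
    rw [← Circle.smul_def, smul_smul, ← AddChar.map_add_eq_mul]
    congr 2
    field_simp
    ring
  rw [Real.fourier_real_eq, Real.fourier_real_eq]
  simp_rw [h]
  rw [integral_smul, Measure.integral_comp_mul_left
      (fun s : ℝ => 𝐞 (-((a + s) * (ξ / T))) • g (a + s)),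
    integral_add_left_eq_self (fun s : ℝ => 𝐞 (-(s * (ξ / T))) • g s),
    abs_of_pos (inv_pos.mpr hT), smul_comm]

theorem IsBandLimited.comp_add_mul {g : ℝ → B} {T : ℝ} (hg : IsBandLimited (c / T) g) (hT : 0 < T)
    (a : ℝ) : IsBandLimited c (fun t => g (a + T * t)) := fun ξ hξ => by
  have hξT : c / T < |ξ / T| := by
    rw [abs_div, abs_of_pos hT]
    gcongr
  rw [fourier_comp_add_mul g a hT, hg _ hξT, smul_zero, smul_zero]

end BandLimited

section Shannon

variable {c : ℝ}

open scoped ContDiff in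
/-- A smooth cutoff on the frequency line, equal to `1` for `|ξ| ≤ c` and to `0` for
`1 - c ≤ |ξ|`; the inner radius is kept positive in order to allow every `c < 1 / 2`. -/
noncomputable def samplingCutoff (hc : c < 1 / 2) : 𝓢(ℝ, ℂ) :=
  let b : ContDiffBump (0 : ℝ) := ⟨max c (1 / 4), 1 - max c (1 / 4), by positivity, by
    linarith [max_lt hc (by norm_num : (1 / 4 : ℝ) < 1 / 2)]⟩
  have hsupp : HasCompactSupport fun ξ : ℝ => ((b ξ : ℝ) : ℂ) :=
    b.hasCompactSupport.comp_left Complex.ofReal_zero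
  have hsmooth : ContDiff ℝ ∞ fun ξ : ℝ => ((b ξ : ℝ) : ℂ) :=
    Complex.ofRealCLM.contDiff.comp b.contDiff
  hsupp.toSchwartzMap hsmooth

theorem samplingCutoff_eq_one (hc : c < 1 / 2) {ξ : ℝ} (hξ : |ξ| ≤ c) :
    samplingCutoff hc ξ = 1 := by
  refine (congrArg Complex.ofReal (ContDiffBump.one_of_mem_closedBall _ ?_)).trans
    Complex.ofReal_one
  simpa using Or.inl hξ

theorem samplingCutoff_eq_zero (hc : c < 1 / 2) {ξ : ℝ} (hξ : 1 - c ≤ |ξ|) :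
    samplingCutoff hc ξ = 0 := by
  refine (congrArg Complex.ofReal (ContDiffBump.zero_of_le_dist _ ?_)).trans
    Complex.ofReal_zero
  have := sub_le_comm.mp hξ |>.trans (le_max_left c (1 / 4))
  simpa using sub_le_comm.mp this

/-- The reconstruction kernel of the sampling formula, a Schwartz function playing the role of the
slowly decaying cardinal sine. -/
noncomputable def samplingKernel (hc : c < 1 / 2) : 𝓢(ℝ, ℂ) := 𝓕⁻ (samplingCutoff hc)

theorem tsum_fourier_add_intCast (H : 𝓢(ℝ, ℂ)) (ξ : ℝ) :
    ∑' k : ℤ, 𝓕 H (ξ + k) = ∑' n : ℤ, H n * 𝐞 (-(n * ξ)) := by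
  have hinv (n : ℤ) : 𝓕 (𝓕 H) (n : ℝ) = H (-n) := by
    rw [SchwartzMap.fourier_coe, ← neg_neg (n : ℝ), ← Real.fourierInv_eq_fourier_neg,
      ← SchwartzMap.fourierInv_coe]
    simp
  rw [SchwartzMap.tsum_eq_tsum_fourier (𝓕 H), ← (Equiv.neg ℤ).tsum_eq]
  congr 1 with n
  rw [Equiv.neg_apply, hinv, fourier_coe_apply, Real.fourierChar_apply]
  push_cast
  ring_nf

-- As `c < 1 / 2`, the periodization of `𝓕 H` agrees with `𝓕 H` on the support of the cutoff.
theorem fourier_eq_samplingCutoff_mul_tsum (hc : c < 1 / 2) {H : 𝓢(ℝ, ℂ)}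
    (hH : IsBandLimited c H) (ξ : ℝ) :
    𝓕 H ξ = samplingCutoff hc ξ * ∑' n : ℤ, H n * 𝐞 (-(n * ξ)) := by
  have hH' (η : ℝ) (hη : c < |η|) : 𝓕 H η = 0 := hH η hη
  rw [← tsum_fourier_add_intCast, ← tsum_mul_left, tsum_eq_single 0]
  · rcases le_or_gt |ξ| c with hξ | hξ
    · simp [samplingCutoff_eq_one hc hξ]
    · simp [hH' ξ hξ]
  · intro k hk
    rcases le_or_gt (1 - c) |ξ| with hξ | hξ
    · rw [samplingCutoff_eq_zero hc hξ, zero_mul]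
    · have hk₁ : (1 : ℝ) ≤ |(k : ℝ)| := by exact_mod_cast Int.one_le_abs hk
      have hk₂ : |(k : ℝ)| ≤ |ξ + k| + |ξ| := by simpa using abs_sub (ξ + k) ξ
      rw [hH' _ (by linarith), mul_zero]

theorem eq_tsum_samplingKernel_mul (hc : c < 1 / 2) {H : 𝓢(ℝ, ℂ)} (hH : IsBandLimited c H)
    (x : ℝ) : H x = ∑' n : ℤ, samplingKernel hc (x - n) * H n := by
  set ψ := samplingCutoff hc
  let G : ℤ → ℝ → ℂ := fun n ξ => H n * (𝐞 (ξ * (x - n)) * ψ ξ)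
  have hG_norm (n : ℤ) (ξ : ℝ) : ‖G n ξ‖ = ‖H n‖ * ‖ψ ξ‖ := by
    simp only [G, norm_mul, Circle.norm_coe, one_mul]
  have hG_int (n : ℤ) : ∫ ξ, G n ξ = samplingKernel hc (x - n) * H n := by
    rw [integral_const_mul, mul_comm, samplingKernel, SchwartzMap.fourierInv_coe,
      Real.fourierInv_eq]
    simp [Circle.smul_def, mul_comm, ψ]
  have hG (n : ℤ) : Integrable (G n) := by
    refine (ψ.integrable.bdd_mul (c := 1) (Continuous.aestronglyMeasurable ?_)
      (.of_forall fun ξ => (Circle.norm_coe _).le)).const_mul _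
    exact continuous_subtype_val.comp (Real.continuous_fourierChar.comp (by fun_prop))
  have hG_sum : Summable fun n => ∫ ξ, ‖G n ξ‖ := by
    simp only [hG_norm, integral_const_mul]
    refine Summable.mul_right _ ?_
    rw [← (Equiv.neg ℤ).summable_iff]
    simpa [Function.comp_def] using summable_norm_sub_intCast H 0
  calc H x = ∫ ξ, 𝐞 (ξ * x) • 𝓕 H ξ := by
        conv_lhs => rw [← FourierTransform.fourierInv_fourier_eq (F := 𝓢(ℝ, ℂ)) H,
          SchwartzMap.fourierInv_coe, Real.fourierInv_eq]
        simp [mul_comm]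
    _ = ∫ ξ, ∑' n, G n ξ := by
        congr 1 with ξ
        rw [fourier_eq_samplingCutoff_mul_tsum hc hH, Circle.smul_def, smul_eq_mul, ← mul_assoc,
          ← tsum_mul_left]
        congr 1 with n
        have hchar : 𝐞 (ξ * (x - n)) = 𝐞 (ξ * x) * 𝐞 (-(n * ξ)) := by
          rw [← AddChar.map_add_eq_mul]
          ring_nf
        simp only [G, ψ, hchar, Circle.coe_mul]
        ring
    _ = ∑' n : ℤ, samplingKernel hc (x - n) * H n := by
        simp only [← hG_int, (hasSum_integral_of_summable_integral_norm hG hG_sum).tsum_eq]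

theorem eq_tsum_samplingKernel_smul {B : Type*} [NormedAddCommGroup B] [NormedSpace ℂ B]
    [CompleteSpace B] (hc : c < 1 / 2) {T : ℝ} (hT : 0 < T) {g : 𝓢(ℝ, B)}
    (hg : IsBandLimited (c / T) g) (a t : ℝ) :
    g (a + T * t) = ∑' n : ℤ, samplingKernel hc (t - n) • g (a + T * n) := by
  obtain ⟨M, -, hM⟩ := exists_norm_rpow_le_mul_one_add_norm_rpow g one_pos 0
  have hsum : Summable fun n : ℤ => samplingKernel hc (t - n) • g (a + T * n) :=
    .of_norm_bounded ((summable_norm_sub_intCast (samplingKernel hc) t).mul_right M) fun n => by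
      rw [norm_smul]
      gcongr
      simpa using hM (a + T * n)
  have hanti : AntilipschitzWith (T⁻¹).toNNReal fun s : ℝ => a + T * s :=
    .of_le_mul_dist fun x y => by
      rw [Real.coe_toNNReal _ (by positivity), dist_add_left, Real.dist_eq, Real.dist_eq,
        ← mul_sub, abs_mul, abs_of_pos hT, inv_mul_cancel_left₀ hT.ne']
  refine (SeparatingDual.eq_iff_forall_dual_eq (R := ℂ)).mpr fun ℓ => ?_
  let H : 𝓢(ℝ, ℂ) := SchwartzMap.compCLMOfAntilipschitz ℂ
    (by fun_prop : (fun s : ℝ => a + T * s).HasTemperateGrowth) hanti (g.postcompCLM ℓ)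
  have hH : IsBandLimited c H := (hg.clm_comp g.integrable ℓ).comp_add_mul hT a
  rw [ℓ.map_tsum hsum]
  simp only [map_smul, smul_eq_mul]
  exact eq_tsum_samplingKernel_mul hc hH t

end Shannon

namespace Adelic

section Reduction

variable {n : ℕ} [NeZero n]

theorem natCast_dvd_of_pow_factorization_dvd {p : ℕ} [Fact p.Prime] {y : ℤ_[p]}
    (hy : (p : ℤ_[p]) ^ n.factorization p ∣ y) : (n : ℤ_[p]) ∣ y := by
  have hu : IsUnit ((n / p ^ n.factorization p : ℕ) : ℤ_[p]) := by
    rw [PadicInt.isUnit_iff, PadicInt.norm_natCast_eq_one_iff]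
    exact Nat.coprime_ordCompl Fact.out (NeZero.ne n)
  rw [← Nat.ordProj_mul_ordCompl_eq_self n p, Nat.cast_mul, hu.mul_right_dvd, Nat.cast_pow]
  exact hy

theorem natCast_dvd_of_modHom_eq_zero {y : ZHat} (hy : modHom n y = 0) : (n : ZHat) ∣ y := by
  have hcomp (p : Nat.Primes) : (n : ℤ_[(p : ℕ)]) ∣ y p := by
    refine natCast_dvd_of_pow_factorization_dvd ?_
    by_cases hp : (p : ℕ) ∣ n
    · have hmem : (p : ℕ) ∈ n.primeFactors := Nat.mem_primeFactors.mpr ⟨p.2, hp, NeZero.ne n⟩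
      have hy' := (map_eq_zero_iff _ (ZMod.equivPi n (NeZero.ne n)).symm.injective).mp hy
      have hyp : PadicInt.toZModPow (p := (p : ℕ)) (n.factorization p) (y p) = 0 :=
        congr_fun hy' ⟨(p : ℕ), hmem⟩
      rwa [← RingHom.mem_ker, PadicInt.ker_toZModPow, Ideal.mem_span_singleton] at hyp
    · simp [Nat.factorization_eq_zero_of_not_dvd hp]
  choose z hz using hcomp
  exact ⟨z, funext hz⟩

theorem modHom_eq_intCast_iff {y : ZHat} {k : ℤ} :
    modHom n y = k ↔ ∃ z : ZHat, y = k + n * z := by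
  refine ⟨fun hy => ?_, fun ⟨z, hz⟩ => by simp [hz]⟩
  obtain ⟨z, hz⟩ := natCast_dvd_of_modHom_eq_zero (n := n) (y := y - k) (by simp [hy])
  exact ⟨z, by rw [← hz, add_sub_cancel]⟩

variable (n) in
theorem exists_eq_intCast_add_natCast_mul (y : ZHat) : ∃ (k : ℤ) (z : ZHat), y = k + n * z := by
  obtain ⟨k, hk⟩ := ZMod.intCast_surjective (modHom n y)
  exact ⟨k, modHom_eq_intCast_iff.mp hk.symm⟩

theorem eq_modHom (φ : ZHat →+* ZMod n) : φ = modHom n := by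
  ext y
  obtain ⟨k, z, rfl⟩ := exists_eq_intCast_add_natCast_mul n y
  simp

theorem castHom_modHom {d : ℕ} [NeZero d] (h : d ∣ n) (y : ZHat) :
    ZMod.castHom h (ZMod d) (modHom n y) = modHom d y :=
  RingHom.congr_fun (eq_modHom ((ZMod.castHom h (ZMod d)).comp (modHom n))) y

variable (n) in
theorem continuous_modHom : Continuous (modHom n) := by
  refine continuous_iff_isClosed.mpr fun s _ => ?_
  rw [← Set.biUnion_preimage_singleton]
  refine s.toFinite.isClosed_biUnion fun b _ => ?_
  obtain ⟨k, rfl⟩ := ZMod.intCast_surjective b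
  have : modHom n ⁻¹' {(k : ZMod n)} = Set.range fun z : ZHat => (k : ZHat) + n * z :=
    Set.ext fun y => modHom_eq_intCast_iff.trans (exists_congr fun z => eq_comm)
  rw [this]
  exact (isCompact_range (by fun_prop)).isClosed

instance : haarZHat.IsAddHaarMeasure := by
  unfold haarZHat
  infer_instance

theorem haarZHat_preimage_modHom_singleton (b : ZMod n) :
    haarZHat (modHom n ⁻¹' {b}) = (n : ℝ≥0∞)⁻¹ := by
  have htranslate (b' : ZMod n) : haarZHat (modHom n ⁻¹' {b'}) = haarZHat (modHom n ⁻¹' {b}) := by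
    obtain ⟨k, hk⟩ := ZMod.intCast_surjective (b' - b)
    rw [← measure_preimage_add haarZHat (k : ZHat)]
    congr 1
    ext y
    simp [hk, ← eq_sub_iff_add_eq']
  have hsum : ∑ b', haarZHat (modHom n ⁻¹' {b'}) = 1 := by
    rw [sum_measure_preimage_singleton _ fun _ _ =>
      (continuous_modHom n).measurable (measurableSet_singleton _)]
    simp
  simp only [htranslate, Finset.sum_const, Finset.card_univ, ZMod.card, nsmul_eq_mul] at hsum
  exact ENNReal.eq_inv_of_mul_eq_one_left (by rwa [mul_comm])

theorem pairZHat_intCast_div (y : ZHat) (a : ℤ) :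
    pairZHat y ((a / n : ℚ) : QModZ) = ZMod.toAddCircle (modHom n y * (a : ZMod n)) := by
  set r : ℚ := a / n with hr
  have : NeZero r.den := ⟨r.den_nz⟩
  have hdvd : r.den ∣ n := by
    rw [hr, ← Int.cast_natCast n, ← Rat.divInt_eq_div]
    exact_mod_cast Rat.den_dvd a n
  obtain ⟨k, z, hy⟩ := exists_eq_intCast_add_natCast_mul n y
  have hyn : modHom n y = k := modHom_eq_intCast_iff.mpr ⟨z, hy⟩
  have hyr : modHom r.den y = k := by rw [← castHom_modHom hdvd, hyn, map_intCast]
  have hratio : (r.num : ℝ) / r.den = a / n := by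
    have : (r : ℝ) = a / n := by simp [hr]
    rw [← this, Rat.cast_def]
  change pairFrac y r.num r.den = _
  rw [pairFrac, hyr, hyn, ← Int.cast_mul, ← Int.cast_mul, ZMod.toAddCircle_intCast,
    ZMod.toAddCircle_intCast]
  push_cast
  rw [mul_div_assoc, mul_div_assoc, hratio]

theorem natCast_mul_intCast_eq_zero_of_mem_fracSubgroup {d : ℕ} [NeZero d] {a : ℤ}
    (h : ((a / n : ℚ) : QModZ) ∈ fracSubgroup d) : (d : ZMod n) * a = 0 := by
  obtain ⟨a', ha'⟩ := h
  obtain ⟨k, hk⟩ := AddSubgroup.mem_zmultiples_iff.mp (QuotientAddGroup.eq.mp ha')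
  have hn : (n : ℚ) ≠ 0 := Nat.cast_ne_zero.mpr (NeZero.ne n)
  have hd : (d : ℚ) ≠ 0 := Nat.cast_ne_zero.mpr (NeZero.ne d)
  rw [zsmul_one] at hk
  field_simp at hk
  have hda : (d * a : ℤ) = n * (a' - k * d) := by
    have : (d * a : ℚ) = n * (a' - k * d) := by linarith
    exact_mod_cast this
  rw [← Int.cast_natCast d, ← Int.cast_mul, ZMod.intCast_zmod_eq_zero_iff_dvd]
  exact ⟨_, hda⟩

end Reduction

end Adelic

theorem integral_prod_apply_eq_sum {α β κ E : Type*} [MeasurableSpace α] [MeasurableSpace β]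
    [Fintype κ] [MeasurableSpace κ] [MeasurableSingletonClass κ] [NormedAddCommGroup E]
    [NormedSpace ℝ E] {μ : Measure α} [SFinite μ] {ν : Measure β} [IsFiniteMeasure ν] {φ : β → κ}
    (hφ : Measurable φ) {G : κ → α → E} (hG : ∀ b, Integrable (G b) μ) :
    ∫ z, G (φ z.2) z.1 ∂μ.prod ν = ∑ b, ν.real (φ ⁻¹' {b}) • ∫ x, G b x ∂μ := by
  classical
  let χ : κ → β → ℝ := fun b => (φ ⁻¹' {b}).indicator 1
  have hfib (b : κ) : MeasurableSet (φ ⁻¹' {b}) := hφ (measurableSet_singleton b)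
  have hχ (b : κ) : Integrable (χ b) ν := (integrable_indicator_iff (hfib b)).mpr integrableOn_const
  have hsplit (z : β × α) : G (φ z.1) z.2 = ∑ b, χ b z.1 • G b z.2 := by
    simp [χ, Set.indicator_apply]
  calc ∫ z, G (φ z.2) z.1 ∂μ.prod ν = ∫ z, G (φ z.1) z.2 ∂ν.prod μ :=
        integral_prod_swap fun z : β × α => G (φ z.1) z.2
    _ = ∑ b, ∫ z, χ b z.1 • G b z.2 ∂ν.prod μ := by
        simp only [hsplit]
        exact integral_finsetSum _ fun b _ => (hχ b).smul_prod (hG b)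
    _ = ∑ b, ν.real (φ ⁻¹' {b}) • ∫ x, G b x ∂μ := by
        simp only [integral_prod_smul, χ, integral_indicator_one (hfib _)]

theorem apply_add_eq_of_invDFT_eq_zero {n : ℕ} [NeZero n] {E : Type*} [AddCommGroup E] [Module ℂ E]
    {Φ : ZMod n → E} {d : ZMod n} (h : ∀ k, d * k ≠ 0 → ZMod.dft.symm Φ k = 0) (b : ZMod n) :
    Φ (b + d) = Φ b := by
  suffices (fun b => Φ (b + d)) = Φ from congr_fun this b
  refine ZMod.dft.symm.injective (funext fun k => ?_)
  have hshift : ZMod.dft.symm (fun b => Φ (b + d)) k =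
      ZMod.stdAddChar (-(d * k)) • ZMod.dft.symm Φ k := by
    simp only [ZMod.invDFT_apply]
    rw [smul_comm]
    congr 1
    rw [Finset.smul_sum]
    refine Fintype.sum_equiv (Equiv.addRight d) _ _ fun j => ?_
    rw [Equiv.coe_addRight, smul_smul, ← AddChar.map_add_eq_mul, add_mul, add_comm (j * k),
      neg_add_cancel_left]
  rw [hshift]
  rcases eq_or_ne (d * k) 0 with hk | hk
  · rw [hk, neg_zero, AddChar.map_zero_eq_one, one_smul]
  · rw [h k hk, smul_zero]

theorem exists_eq_comp_castHom_of_periodic {d n : ℕ} [NeZero n] {X : Type*} (h : d ∣ n)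
    {f : ZMod n → X} (hf : Function.Periodic f (d : ZMod n)) :
    ∃ g : ZMod d → X, f = g ∘ ZMod.castHom h (ZMod d) := by
  refine ⟨fun b => f (b.val : ZMod n), funext fun b => ?_⟩
  have hf' : Function.Periodic (fun k : ℕ => f k) d := fun k => by
    simpa using hf k
  obtain ⟨k, rfl⟩ := ZMod.natCast_zmod_surjective b
  simpa [ZMod.val_natCast] using (hf'.map_mod_nat k).symm

namespace Adelic

section Level

variable {B : Type*} [NormedAddCommGroup B] [NormedSpace ℂ B] {n : ℕ} [NeZero n]

/-- The function `(x, y) ↦ f (x, y mod n)` on `𝔸_ℤ` with components `f b`, `b ∈ ℤ/nℤ`. The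
Schwartz–Bruhat functions are those of this form, for some level `n`. -/
noncomputable def ofLevel (n : ℕ) [NeZero n] (f : ZMod n → 𝓢(ℝ, B)) : AZ → B :=
  fun z => f (modHom n z.2) z.1

theorem continuous_ofLevel (f : ZMod n → 𝓢(ℝ, B)) : Continuous (ofLevel n f) := by
  have : Continuous fun w : ℝ × ZMod n => f w.2 w.1 :=
    continuous_prod_of_discrete_right.mpr fun b => (f b).continuous
  exact this.comp (continuous_fst.prodMk ((continuous_modHom n).comp continuous_snd))

theorem IsSchwartzBruhat.exists_eq_ofLevel {F : AZ → B} (hF : IsSchwartzBruhat F) :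
    ∃ (n : ℕ) (_ : NeZero n) (f : ZMod n → 𝓢(ℝ, B)), F = ofLevel n f := by
  obtain ⟨n, hn, f, hf⟩ := hF
  exact ⟨n, hn, f, funext fun z => hf z.1 z.2⟩

theorem ofLevel_comp_castHom {d : ℕ} [NeZero d] (h : d ∣ n) (f : ZMod d → 𝓢(ℝ, B)) :
    ofLevel n (f ∘ ZMod.castHom h (ZMod d)) = ofLevel d f := by
  ext z
  rw [ofLevel, Function.comp_apply, castHom_modHom, ofLevel]

theorem toCircle_pairAZ (z : AZ) (ξ : ℝ) (a : ℤ) :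
    (AddCircle.toCircle (pairAZ z (ξ, ((a / n : ℚ) : QModZ))) : ℂ) =
      𝐞 (z.1 * ξ) * ZMod.stdAddChar (modHom n z.2 * (a : ZMod n)) := by
  have hreal : (AddCircle.toCircle ((z.1 * ξ : ℝ) : UnitAddCircle) : ℂ) = 𝐞 (z.1 * ξ) := by
    simp [AddCircle.toCircle_apply_mk, Real.fourierChar_apply']
  rw [pairAZ, pairZHat_intCast_div, AddCircle.toCircle_add, Circle.coe_mul, hreal,
    ZMod.stdAddChar_apply]
  rfl

theorem fourierAZ_ofLevel (f : ZMod n → 𝓢(ℝ, B)) (ξ : ℝ) (a : ℤ) :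
    fourierAZ (ofLevel n f) (ξ, ((a / n : ℚ) : QModZ)) =
      ZMod.dft.symm (fun b => 𝓕⁻ (f b : ℝ → B) ξ) a := by
  let G : ZMod n → ℝ → B := fun b x => ZMod.stdAddChar (b * (a : ZMod n)) • 𝐞 (x * ξ) • f b x
  have hG (b : ZMod n) : Integrable (G b) := by
    have := (Real.fourierIntegral_convergent_iff (-ξ)).mpr ((f b).integrable (μ := volume))
    exact .smul _ (by simpa [mul_comm] using this)
  have hG_int (b : ZMod n) : ∫ x, G b x =
      ZMod.stdAddChar (b * (a : ZMod n)) • 𝓕⁻ (f b : ℝ → B) ξ := by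
    rw [integral_smul, Real.fourierInv_eq]
    simp [mul_comm]
  have hmass (b : ZMod n) : haarZHat.real (modHom n ⁻¹' {b}) = (n : ℝ)⁻¹ := by
    simp [measureReal_def, haarZHat_preimage_modHom_singleton]
  calc fourierAZ (ofLevel n f) (ξ, ((a / n : ℚ) : QModZ))
      = ∫ z, G (modHom n z.2) z.1 ∂haarAZ := by
        rw [fourierAZ]
        congr 1 with z
        rw [toCircle_pairAZ, mul_comm, mul_smul]
        rfl
    _ = ∑ b, (n : ℝ)⁻¹ • ZMod.stdAddChar (b * (a : ZMod n)) • 𝓕⁻ (f b : ℝ → B) ξ := by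
        rw [haarAZ, integral_prod_apply_eq_sum (continuous_modHom n).measurable hG]
        simp only [hmass, hG_int]
    _ = _ := by
        rw [ZMod.invDFT_apply, ← Finset.smul_sum]
        simp only [← Complex.ofReal_natCast, ← Complex.ofReal_inv, Complex.coe_smul]

theorem continuous_fourierAZ_ofLevel (f : ZMod n → 𝓢(ℝ, B)) (a : ℤ) :
    Continuous fun ξ => fourierAZ (ofLevel n f) (ξ, ((a / n : ℚ) : QModZ)) := by
  have hf (b : ZMod n) : Continuous (𝓕⁻ (f b : ℝ → B)) := by
    rw [← SchwartzMap.fourierInv_coe]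
    exact (𝓕⁻ (f b)).continuous
  simp only [fourierAZ_ofLevel, ZMod.invDFT_apply]
  fun_prop

theorem FourierSupportedIn.fourierAZ_eq_zero {F : AZ → B} {Ω : Set (ℝ × QModZ)}
    (hF : FourierSupportedIn F Ω) {α : QModZ} (hcont : Continuous fun ξ => fourierAZ F (ξ, α))
    (hΩ : IsClosed {ξ | (ξ, α) ∈ Ω}) {ξ : ℝ} (hξ : (ξ, α) ∉ Ω) : fourierAZ F (ξ, α) = 0 := by
  have hae : ∀ᵐ ξ, (ξ, α) ∉ Ω → fourierAZ F (ξ, α) = 0 := by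
    filter_upwards [Measure.ae_ae_of_ae_prod hF] with ξ h
    exact (Measure.ae_count_iff.mp h) α
  refine Measure.eqOn_open_of_ae_eq (μ := volume) ?_ hΩ.isOpen_compl hcont.continuousOn
    continuousOn_const hξ
  exact (ae_restrict_iff' hΩ.isOpen_compl.measurableSet).mpr hae

theorem isBandLimited_of_fourierSupportedIn {f : ZMod n → 𝓢(ℝ, B)} {r : ℝ} {T : Set QModZ}
    (hf : FourierSupportedIn (ofLevel n f) (Set.Icc (-r) r ×ˢ T)) (b : ZMod n) :
    IsBandLimited r (f b) := fun ξ hξ => by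
  have hzero : (fun b => 𝓕⁻ (f b : ℝ → B) (-ξ)) = 0 := by
    refine ZMod.dft.symm.injective (funext fun k => ?_)
    obtain ⟨a, rfl⟩ := ZMod.intCast_surjective k
    rw [← fourierAZ_ofLevel, map_zero]
    refine hf.fourierAZ_eq_zero (continuous_fourierAZ_ofLevel f a) ?_ fun h => ?_
    · simp only [Set.mem_prod]
      exact isClosed_Icc.and isClosed_const
    · exact hξ.not_ge ((abs_neg ξ).symm.trans_le (abs_le.mpr h.1))
  rw [← neg_neg ξ, ← Real.fourierInv_eq_fourier_neg]
  exact congr_fun hzero b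

theorem periodic_of_fourierSupportedIn [CompleteSpace B] {d : ℕ} [NeZero d]
    {f : ZMod n → 𝓢(ℝ, B)} {S : Set ℝ} (hS : IsClosed S)
    (hf : FourierSupportedIn (ofLevel n f) (S ×ˢ fracSubgroup d)) :
    Function.Periodic f (d : ZMod n) := fun b => by
  have hinv (ξ : ℝ) : 𝓕⁻ (f (b + d)) ξ = 𝓕⁻ (f b) ξ := by
    simp only [SchwartzMap.fourierInv_coe]
    refine apply_add_eq_of_invDFT_eq_zero (Φ := fun b => 𝓕⁻ (f b : ℝ → B) ξ) (fun k hk => ?_) b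
    obtain ⟨a, rfl⟩ := ZMod.intCast_surjective k
    rw [← fourierAZ_ofLevel]
    refine hf.fourierAZ_eq_zero (continuous_fourierAZ_ofLevel f a) ?_ fun h => ?_
    · simp only [Set.mem_prod]
      exact hS.and isClosed_const
    · exact hk (natCast_mul_intCast_eq_zero_of_mem_fracSubgroup h.2)
  exact (FourierTransform.fourierEquiv ℂ 𝓢(ℝ, B)).symm.injective (SchwartzMap.ext hinv)

theorem IsSchwartzBruhat.exists_eq_ofLevel_isBandLimited [CompleteSpace B] {F : AZ → B}
    (hF : IsSchwartzBruhat F) {Q : ℕ} [NeZero Q] {r : ℝ}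
    (hsupp : FourierSupportedIn F (Set.Icc (-r) r ×ˢ fracSubgroup Q)) :
    ∃ g : ZMod Q → 𝓢(ℝ, B), F = ofLevel Q g ∧ ∀ b, IsBandLimited r (g b) := by
  obtain ⟨m, _, f₀, rfl⟩ := hF.exists_eq_ofLevel
  rw [← ofLevel_comp_castHom (Nat.dvd_mul_right m Q)] at hsupp ⊢
  obtain ⟨g, hg⟩ := exists_eq_comp_castHom_of_periodic (Nat.dvd_mul_left Q m)
    (periodic_of_fourierSupportedIn isClosed_Icc hsupp)
  rw [hg] at hsupp ⊢
  refine ⟨g, ofLevel_comp_castHom _ g, fun b => ?_⟩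
  obtain ⟨b, rfl⟩ := ZMod.castHom_surjective (Nat.dvd_mul_left Q m) b
  exact isBandLimited_of_fourierSupportedIn hsupp b

end Level

section Lattice

/-- The translation action of the lattice `ℤ` on `𝔸_ℤ`, through the diagonal embedding. -/
noncomputable instance : AddAction ℤ AZ := AddAction.compHom AZ (Int.castAddHom AZ)

theorem int_vadd_eq (n : ℤ) (z : AZ) : n +ᵥ z = (n : AZ) + z := rfl

theorem sampling_eq_orbit_zero {B : Type*} (F : AZ → B) :
    sampling F = fun n : ℤ => F (n +ᵥ (0 : AZ)) := by
  ext n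
  rw [int_vadd_eq, add_zero]
  rfl

instance : MeasurableConstVAdd ℤ AZ := ⟨fun n => measurable_const_add (n : AZ)⟩

instance : haarAZ.IsAddHaarMeasure := by
  unfold haarAZ
  infer_instance

instance : VAddInvariantMeasure ℤ AZ haarAZ :=
  ⟨fun n s _ => measure_preimage_add haarAZ (n : AZ) s⟩

theorem isAddFundamentalDomain_preimage_Ioc :
    IsAddFundamentalDomain ℤ (Prod.fst ⁻¹' Set.Ioc 0 1 : Set AZ) haarAZ := by
  refine .mk' (measurable_fst measurableSet_Ioc).nullMeasurableSet fun z => ?_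
  simpa [int_vadd_eq, add_comm] using existsUnique_add_zsmul_mem_Ioc one_pos z.1 0

theorem haarAZ_preimage_Ioc : haarAZ (Prod.fst ⁻¹' Set.Ioc 0 1) = 1 := by
  rw [haarAZ, ← Set.prod_univ, Measure.prod_prod]
  simp

end Lattice

section Kernel

variable {c : ℝ} (hc : c < 1 / 2) {Q : ℕ} [NeZero Q]

theorem tsum_ite_intCast_eq {M : Type*} [AddCommMonoid M] [TopologicalSpace M] (f : ℤ → M)
    (k : ℤ) : ∑' n : ℤ, (if (n : ZMod Q) = k then f n else 0) = ∑' m : ℤ, f (k + Q * m) := by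
  have hinj : Function.Injective fun m : ℤ => k + Q * m := fun m m' h => by
    simpa [NeZero.ne Q] using h
  rw [← hinj.tsum_eq]
  · simp
  · intro n hn
    have hn' : (k : ZMod Q) = n := by
      by_contra h
      exact hn (if_neg (Ne.symm h))
    obtain ⟨m, hm⟩ := (ZMod.intCast_eq_intCast_iff_dvd_sub _ _ _).mp hn'
    exact ⟨m, by simp [← hm]⟩

variable (Q) in
/-- The reconstruction kernel on `𝔸_ℤ` for sampling at level `Q`: the dilate by `Q` of the
real kernel, supported on `ℝ × QẐ`. -/
noncomputable def adelicKernel (z : AZ) : ℂ :=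
  if modHom Q z.2 = 0 then samplingKernel hc (z.1 / Q) else 0

theorem adelicKernel_sub_intCast {v : AZ} {k : ℤ} (hk : modHom Q v.2 = k) (n : ℤ) :
    adelicKernel hc Q (v - n) =
      if (n : ZMod Q) = k then samplingKernel hc ((v.1 - n) / Q) else 0 := by
  simp [adelicKernel, hk, sub_eq_zero, eq_comm]

theorem exists_tsum_enorm_adelicKernel_rpow_le {r : ℝ} (hr : 0 < r) :
    ∃ K : ℝ≥0, ∀ (Q : ℕ) [NeZero Q] (v : AZ),
      ∑' n : ℤ, ‖adelicKernel hc Q (v - n)‖ₑ ^ r ≤ K := by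
  obtain ⟨K, hK⟩ := exists_tsum_enorm_rpow_sub_intCast_le (samplingKernel hc) hr
  refine ⟨K, fun Q _ v => ?_⟩
  obtain ⟨k, hk⟩ := ZMod.intCast_surjective (modHom Q v.2)
  have hQ : (Q : ℝ) ≠ 0 := NeZero.ne _
  calc ∑' n : ℤ, ‖adelicKernel hc Q (v - n)‖ₑ ^ r
      = ∑' n : ℤ, if (n : ZMod Q) = k then ‖samplingKernel hc ((v.1 - n) / Q)‖ₑ ^ r else 0 := by
        congr 1 with n
        rw [adelicKernel_sub_intCast hc hk.symm]
        split_ifs <;> simp [hr]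
    _ = ∑' m : ℤ, ‖samplingKernel hc ((v.1 - k) / Q - m)‖ₑ ^ r := by
        rw [tsum_ite_intCast_eq]
        congr! 5 with m
        push_cast
        field_simp
        ring
    _ ≤ K := hK _

variable {B : Type*} [NormedAddCommGroup B] [NormedSpace ℂ B] [CompleteSpace B]

theorem ofLevel_eq_tsum_adelicKernel_smul {g : ZMod Q → 𝓢(ℝ, B)}
    (hg : ∀ b, IsBandLimited (c / Q) (g b)) (w z : AZ) :
    ofLevel Q g w = ∑' n : ℤ, adelicKernel hc Q (w - (n +ᵥ z)) • ofLevel Q g (n +ᵥ z) := by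
  obtain ⟨k, hk⟩ := ZMod.intCast_surjective (modHom Q (w - z).2)
  have hQ : (0 : ℝ) < Q := Nat.cast_pos.mpr (NeZero.pos Q)
  have hkz : (k : ZMod Q) + modHom Q z.2 = modHom Q w.2 := by simp [hk]
  have hterm (n : ℤ) : adelicKernel hc Q (w - (n +ᵥ z)) • ofLevel Q g (n +ᵥ z) =
      if (n : ZMod Q) = k then
        samplingKernel hc (((w - z).1 - n) / Q) • g (modHom Q w.2) (n + z.1) else 0 := by
    rw [int_vadd_eq, sub_add_eq_sub_sub_swap, adelicKernel_sub_intCast hc hk.symm, ite_smul,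
      zero_smul]
    refine ite_congr rfl (fun hn => ?_) fun _ => rfl
    simp [ofLevel, hn, hkz]
  simp only [hterm]
  rw [tsum_ite_intCast_eq]
  have hw : k + z.1 + Q * (((w - z).1 - k) / Q) = w.1 := by
    rw [mul_div_cancel₀ _ hQ.ne', Prod.fst_sub]
    ring
  calc ofLevel Q g w = g (modHom Q w.2) (k + z.1 + Q * (((w - z).1 - k) / Q)) := by
        rw [hw, ofLevel]
    _ = _ := eq_tsum_samplingKernel_smul hc hQ (hg _) _ _
    _ = _ := by
        congr 1 with m
        push_cast
        congr 2
        · field_simp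
          ring
        · ring

theorem eLpNorm_orbit_le {g : ZMod Q → 𝓢(ℝ, B)} (hg : ∀ b, IsBandLimited (c / Q) (g b))
    {p A : ℝ≥0∞} (hp : p ≠ 0)
    (hA : ∀ v : AZ, ∑' n : ℤ, ‖adelicKernel hc Q (v - n)‖ₑ ^ (min p 1).toReal ≤ A) (w z : AZ) :
    eLpNorm (fun n : ℤ => ofLevel Q g (n +ᵥ w)) p Measure.count ≤
      A ^ (min p 1).toReal⁻¹ *
        eLpNorm (fun n : ℤ => ofLevel Q g (n +ᵥ z)) p Measure.count := by
  refine eLpNorm_count_le_of_tsum_kernel_le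
    (k := fun n m => ‖adelicKernel hc Q ((n +ᵥ w) - (m +ᵥ z))‖ₑ) hp (fun n => ?_) (fun n => ?_)
    fun m => ?_
  · rw [ofLevel_eq_tsum_adelicKernel_smul hc hg (n +ᵥ w) z]
    simp only [← enorm_smul]
    exact enorm_tsum_le_tsum_enorm
  · simpa only [int_vadd_eq, sub_add_eq_sub_sub_swap] using hA ((n +ᵥ w) - z)
  · rw [← (Equiv.neg ℤ).tsum_eq]
    convert hA (w - (m +ᵥ z)) using 6 with n
    simp only [int_vadd_eq, Equiv.neg_apply, Int.cast_neg]
    abel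

end Kernel

section Norms

variable {B : Type*} [NormedAddCommGroup B] {F : AZ → B} {p C : ℝ≥0∞}

theorem eLpNorm_le_mul_eLpNorm_sampling (hF : AEStronglyMeasurable F haarAZ) (hp : p ≠ 0)
    (h : ∀ w z : AZ, eLpNorm (fun n : ℤ => F (n +ᵥ w)) p Measure.count ≤
      C * eLpNorm (fun n : ℤ => F (n +ᵥ z)) p Measure.count) :
    eLpNorm F p haarAZ ≤ C * eLpNorm (sampling F) p Measure.count := by
  rw [sampling_eq_orbit_zero]
  simpa [haarAZ_preimage_Ioc] using
    eLpNorm_le_of_forall_orbit_le isAddFundamentalDomain_preimage_Ioc hF hp fun w => h w 0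

theorem eLpNorm_sampling_le_mul_eLpNorm (hF : AEStronglyMeasurable F haarAZ) (hp : p ≠ 0)
    (hC : C ≠ 0) (hC_top : C ≠ ∞)
    (h : ∀ w z : AZ, eLpNorm (fun n : ℤ => F (n +ᵥ w)) p Measure.count ≤
      C * eLpNorm (fun n : ℤ => F (n +ᵥ z)) p Measure.count) :
    eLpNorm (sampling F) p Measure.count ≤ C * eLpNorm F p haarAZ := by
  rw [sampling_eq_orbit_zero, ← ENNReal.div_le_iff' hC hC_top]
  simpa [haarAZ_preimage_Ioc] using
    le_eLpNorm_of_forall_le_orbit isAddFundamentalDomain_preimage_Ioc hF hp fun z =>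
      ENNReal.div_le_of_le_mul' (h 0 z)

end Norms

end Adelic

theorem mainTheorem9_general {p : ℝ≥0∞} (hp : 0 < p) {c₀ : ℝ} (hc₀ : c₀ < 1 / 2) :
    ∃ C : ℝ≥0, 0 < C ∧
      ∀ (B : Type*) [NormedAddCommGroup B] [NormedSpace ℂ B] [CompleteSpace B]
        (Q : ℕ), 0 < Q → ∀ F : Adelic.AZ → B, Adelic.IsSchwartzBruhat F →
        Adelic.FourierSupportedIn F
          (Set.Icc (-(c₀ / Q)) (c₀ / Q) ×ˢ Adelic.fracSubgroup Q) →
        eLpNorm (Adelic.sampling F) p Measure.count ≤ C * eLpNorm F p Adelic.haarAZ ∧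
        eLpNorm F p Adelic.haarAZ ≤ C * eLpNorm (Adelic.sampling F) p Measure.count := by
  have hr : 0 < (min p 1).toReal := ENNReal.toReal_pos (by simp [hp.ne']) (by simp)
  obtain ⟨K, hK⟩ := Adelic.exists_tsum_enorm_adelicKernel_rpow_le hc₀ hr
  refine ⟨(K + 1) ^ (min p 1).toReal⁻¹, by positivity, fun B _ _ _ Q hQ F hF hsupp => ?_⟩
  have : NeZero Q := ⟨hQ.ne'⟩
  obtain ⟨g, rfl, hg⟩ := hF.exists_eq_ofLevel_isBandLimited hsupp
  have hmeas : AEStronglyMeasurable (Adelic.ofLevel Q g) Adelic.haarAZ :=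
    (Adelic.continuous_ofLevel g).aestronglyMeasurable
  have horbit := Adelic.eLpNorm_orbit_le hc₀ hg hp.ne' fun v =>
    (hK Q v).trans (ENNReal.coe_le_coe.mpr (le_add_of_nonneg_right zero_le_one))
  rw [← ENNReal.coe_rpow_of_nonneg _ (by positivity)] at horbit
  exact ⟨Adelic.eLpNorm_sampling_le_mul_eLpNorm hmeas hp.ne' (by positivity) (by simp) horbit,
    Adelic.eLpNorm_le_mul_eLpNorm_sampling hmeas hp.ne' horbit⟩

theorem mainTheorem9 (p : ℝ≥0∞) (hp : 0 < p) (c₀ : ℝ) (hc₀ : 0 < c₀) (hc₀' : c₀ < 1 / 2) :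
    ∃ C : ℝ≥0, 0 < C ∧
      ∀ (B : Type*) [NormedAddCommGroup B] [NormedSpace ℂ B] [FiniteDimensional ℂ B]
        (Q : ℕ), 0 < Q → ∀ F : Adelic.AZ → B, Adelic.IsSchwartzBruhat F →
        Adelic.FourierSupportedIn F
          (Set.Icc (-(c₀ / Q)) (c₀ / Q) ×ˢ Adelic.fracSubgroup Q) →
        eLpNorm (Adelic.sampling F) p Measure.count ≤ C * eLpNorm F p Adelic.haarAZ ∧
        eLpNorm F p Adelic.haarAZ ≤ C * eLpNorm (Adelic.sampling F) p Measure.count := by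
  obtain ⟨C, hC, h⟩ := mainTheorem9_general hp hc₀'
  refine ⟨C, hC, fun B _ _ _ => ?_⟩
  have : CompleteSpace B := FiniteDimensional.complete ℂ B
  exact h B
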